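/- Let $n\ge 1$, let $q\ge 1$ be a real number and let $x_1,\dots,x_n>0$ be real numbers (the rates; they are probabilities when $x_1+\cdots+x_n=1$). Write $\pi=\pi_1\cdots\pi_n\in\mathfrak S_n$ in one-line notation and let $s_i$ be the transposition of $i$ and $i+1$. Let the Hecke generators $T_1,\dots,T_{n-1}$ act from the right on the real vector space with basis $\mathfrak S_n$ by $$\pi\cdot T_i=\begin{cases} q\,\pi s_i & \text{if }\pi_{i+1}<\pi_i,\\ \pi s_i+(q-1)\pi & \text{if }\pi_{i+1}>\pi_i,\end{cases}$$ and let $\pi\cdot\mathcal X=\dfrac{x_{\pi_1}}{q^{\,n-\pi_1}}\,\pi$. The $q$-Tsetlin library on permutations is the right operator $$\mathcal T(q,\mathsf x)=\Big(\sum_{i=1}^{n}T_{i-1}T_{i-2}\cdots T_1\Big)\mathcal X ,$$ where the $i=1$ term of the sum is the identity and products act from left to right. Its stationary distribution is the vector $\Psi=\sum_\pi\Psi_\pi\,\pi$ with $\Psi_\pi\ge 0$, $\sum_\pi\Psi_\pi=1$ and $\Psi\cdot\mathcal T(q,\mathsf x)=(x_1+\cdots+x_n)\Psi$. For a weakly decreasing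 tuple $\mathsf b=(b_1,\dots,b_k)$ of elements of $\{1,\dots,n\}$ put $\kappa(\mathsf b;\mathsf x)=\sum_{i=1}^{k}x_{b_i}q^{\,i+b_i-k-1}$; for an arbitrary tuple, $\kappa(\mathsf b;\mathsf x)$ is the value of $\kappa$ at the weakly decreasing rearrangement of $\mathsf b$. Let $w_0=n\,(n-1)\cdots 1$, let $\mathrm{inv}(\pi)$ be the number of pairs $i<j$ with $\pi_i>\pi_j$, let $\mathrm{LRM}(\pi)$ be the set of positions $k$ with $\pi_i>\pi_k$ for all $i<k$, and for $k\notin\mathrm{LRM}(\pi)$ let $p_k$ be the smallest $i<k$ with $\pi_i<\pi_k$. Then the following hold. 1. The stationary distribution exists, is unique, and for every $\pi\in\mathfrak S_n$ $$\Psi_\pi=\frac{q^{-\mathrm{inv}(\pi)}}{\prod_{k=1}^{n-1}\big(\kappa(w_0;\mathsf x)-q^{k-n-1}\kappa(\pi_1,\dots,\pi_{k-1};\mathsf x)\big)}\prod_{\substack{1\le k\le n-1\\ k\in\mathrm{LRM}(\pi)}}\kappa(\pi_k;\mathsf x)\prod_{\substack{1\le k\le n-1\\ k\notin\mathrm{LRM}(\pi)}}\Big(\kappa(\pi_{p_k},\dots,\pi_k;\mathsf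 x)-q^{-1}\kappa(\pi_{p_k},\dots,\pi_{k-1};\mathsf x)\Big).$$ 2. Each factor on the right-hand side is positive: $q^{-\mathrm{inv}(\pi)}$, each factor of the denominator, and each factor of the two products in the numerator. 3. The right-hand sides, summed over all $\pi\in\mathfrak S_n$, give $1$. -/

import Mathlib

open scoped BigOperators

namespace QTsetlin

noncomputable section

/-! Permutations of `{1, …, n}` are elements `π` of `Equiv.Perm (Fin n)`, read in one-line notation.
Positions and letters are shifted by one: `π j` is the letter `π_{j+1}`, and the element `a` of
`Fin n` stands for the letter `a + 1`, so that `x a` is the rate `x_{a+1}`. -/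

/-- The real vector space with basis the permutations. An element `Ψ` stands for the row vector
`∑ π, Ψ π • π`. Operators that act from the right on row vectors are written as linear maps, so
that the right action of a product `A B` is the linear map `B ∘ A`. -/
abbrev PermSpace (n : ℕ) : Type := Equiv.Perm (Fin n) →₀ ℝ

/-- The right action of the Hecke generator `T_{i+1}`, which concerns the positions
`i + 1` and `i + 2` of the word (these are the elements `i` and `i + 1` of `Fin n`):
`π · T = q (π s)` if there is a descent, and `π · T = π s + (q - 1) π` if there is an ascent. -/
def heckeT {n : ℕ} (q : ℝ) (i : ℕ) (h : i + 1 < n) : PermSpace n →ₗ[ℝ] PermSpace n :=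
  Finsupp.linearCombination ℝ (fun π : Equiv.Perm (Fin n) =>
    let a : Fin n := ⟨i, Nat.lt_of_succ_lt h⟩
    let b : Fin n := ⟨i + 1, h⟩
    if π b < π a then
      q • Finsupp.single (π * Equiv.swap a b) (1 : ℝ)
    else
      Finsupp.single (π * Equiv.swap a b) (1 : ℝ) + (q - 1) • Finsupp.single π (1 : ℝ))

/-- The right action of `T_m T_{m-1} ⋯ T_1` (first `T_m`, last `T_1`); the identity for `m = 0`. -/
def heckeDescend {n : ℕ} (q : ℝ) : (m : ℕ) → m < n → (PermSpace n →ₗ[ℝ] PermSpace n)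
  | 0, _ => LinearMap.id
  | m + 1, h => (heckeDescend q m (Nat.lt_of_succ_lt h)).comp (heckeT q m h)

/-- The right action of `∑_{i=1}^{n} T_{i-1} ⋯ T_1`, which is `[n]_q` times `q`-random-to-top. -/
def heckeSum (n : ℕ) (q : ℝ) : PermSpace n →ₗ[ℝ] PermSpace n :=
  ∑ i : Fin n, heckeDescend q (i : ℕ) i.isLt

/-- The weight operator `π · X = (x_{π_1} / q^{n - π_1}) π`. -/
def weightX {n : ℕ} [NeZero n] (q : ℝ) (x : Fin n → ℝ) : PermSpace n →ₗ[ℝ] PermSpace n :=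
  Finsupp.linearCombination ℝ (fun π : Equiv.Perm (Fin n) =>
    (x (π 0) / q ^ (n - ((π 0 : ℕ) + 1))) • Finsupp.single π (1 : ℝ))

/-- The `q`-Tsetlin library on permutations: the right action of
`∑_{i=1}^{n} T_{i-1} ⋯ T_1` followed by the weight operator. -/
def qTsetlin {n : ℕ} [NeZero n] (q : ℝ) (x : Fin n → ℝ) : PermSpace n →ₗ[ℝ] PermSpace n :=
  (weightX q x).comp (heckeSum n q)

/-- A stationary distribution of the `q`-Tsetlin library: a probability vector which is a left
eigenvector with eigenvalue `x_1 + ⋯ + x_n` (this eigenvalue is `1` if the rates sum to `1`). -/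
structure IsStationaryDistribution {n : ℕ} [NeZero n] (q : ℝ) (x : Fin n → ℝ)
    (Ψ : PermSpace n) : Prop where
  nonneg : ∀ π, 0 ≤ Ψ π
  sum_eq_one : ∑ π, Ψ π = 1
  eigenvector : qTsetlin q x Ψ = (∑ i, x i) • Ψ

/-- `κ(b; x) = ∑_{i=1}^{k} x_{b_i} q^{i + b_i - k - 1}` for a weakly decreasing tuple
`b = (b_1, …, b_k)`; an arbitrary tuple is first sorted into weakly decreasing order. -/
def kappa {n : ℕ} (q : ℝ) (x : Fin n → ℝ) (b : List (Fin n)) : ℝ :=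
  let c := b.insertionSort (fun a a' => a ≥ a')
  ∑ i : Fin c.length, x (c.get i) *
    q ^ ((((i : ℕ) : ℤ) + 1) + (((c.get i : ℕ) : ℤ) + 1) - (c.length : ℤ) - 1)

/-- The one-line notation of a permutation. -/
def word {n : ℕ} (π : Equiv.Perm (Fin n)) : List (Fin n) := List.ofFn π

/-- The set of positions of the left-to-right minima. -/
def LRM {n : ℕ} (π : Equiv.Perm (Fin n)) : Finset (Fin n) :=
  Finset.univ.filter (fun k => ∀ i, i < k → π k < π i)

/-- The smallest position `i` before `k` with `π_i < π_k` (counted from `0`); it is only used when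
`k` is not a left-to-right minimum, so that there is such a position. -/
def firstSmaller {n : ℕ} (π : Equiv.Perm (Fin n)) (k : Fin n) : ℕ :=
  sInf {i : ℕ | ∃ j : Fin n, (j : ℕ) = i ∧ j < k ∧ π j < π k}

/-- The number of inversions. -/
def inv {n : ℕ} (π : Equiv.Perm (Fin n)) : ℕ :=
  (Finset.univ.filter (fun p : Fin n × Fin n => p.1 < p.2 ∧ π p.2 < π p.1)).card

/-- The long permutation `n n-1 … 1`. -/
def longPerm (n : ℕ) : Equiv.Perm (Fin n) := Fin.revPerm

/-- All positions except the last one. -/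
def positions (n : ℕ) : Finset (Fin n) :=
  Finset.univ.filter (fun k : Fin n => (k : ℕ) + 1 < n)

/-- With `k' = k + 1` the position counted from `1`, the factor
`κ(w_0; x) - q^{k'-n-1} κ(π_1, …, π_{k'-1}; x)`. -/
def denomFactor {n : ℕ} (q : ℝ) (x : Fin n → ℝ) (π : Equiv.Perm (Fin n)) (k : Fin n) : ℝ :=
  kappa q x (word (longPerm n)) -
    q ^ ((((k : ℕ) : ℤ) + 1) - (n : ℤ) - 1) * kappa q x ((word π).take (k : ℕ))

/-- The factor `κ(π_k; x)` that belongs to a left-to-right minimum. -/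
def minFactor {n : ℕ} (q : ℝ) (x : Fin n → ℝ) (π : Equiv.Perm (Fin n)) (k : Fin n) : ℝ :=
  kappa q x [π k]

/-- The factor `κ(π_{p_k}, …, π_k; x) - q^{-1} κ(π_{p_k}, …, π_{k-1}; x)` that belongs to a
position which is not a left-to-right minimum. -/
def nonminFactor {n : ℕ} (q : ℝ) (x : Fin n → ℝ) (π : Equiv.Perm (Fin n)) (k : Fin n) : ℝ :=
  kappa q x (((word π).take ((k : ℕ) + 1)).drop (firstSmaller π k)) -
    q⁻¹ * kappa q x (((word π).take (k : ℕ)).drop (firstSmaller π k))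

/-- The product formula for the component at `π`. -/
def stationaryFormula {n : ℕ} (q : ℝ) (x : Fin n → ℝ) (π : Equiv.Perm (Fin n)) : ℝ :=
  q ^ (-(inv π : ℤ)) / (∏ k ∈ positions n, denomFactor q x π k) *
    ((∏ k ∈ (positions n).filter (fun k => k ∈ LRM π), minFactor q x π k) *
      ∏ k ∈ (positions n).filter (fun k => k ∉ LRM π), nonminFactor q x π k)

end

end QTsetlin

namespace QTsetlin

/-! The stationary vector is a product of conditional probabilities. Once a set S of letters has
been placed, the next letter is c with probability δ_S(c) / (q^{gap_S(c)} D_S), where δ_S(c) = κ(S ∪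
{c}) − q⁻¹ κ(S) is `increment` and D_S is `setDenom`. A geometric sum (`sum_increment`) shows that
these probabilities add up to 1 over c ∉ S. This gives the total mass and also D_S > 0.

For the eigenvector equation the sum of the T_m ⋯ T_1 is treated one letter at a time. For prefixes
of length k + 1, a single term, T_k ⋯ T_1 applied to `insertWeight`, stands in for all m ≥ k.
Lengthening the prefix needs only the two-letter identity `prefixProb_exchange`, which comes down to
how δ and D change when one letter joins S. At full length `insertWeight` is the candidate itself.

Uniqueness is a Perron–Frobenius argument: subtract from a stationary vector the largest multiple of
the candidate that keeps it nonnegative; the resulting zero spreads to all permutations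
(`eq_zero_of_eigenvector`).

The closed formula follows because δ_S(c) sees only the letters of S below c, so the letters before
position p_k may be dropped. -/

/-- The number of elements below `a` that are missing from `S`. -/
def gap {n : ℕ} (S : Finset (Fin n)) (a : Fin n) : ℕ := ((Sᶜ).filter (· < a)).card

/-- The value of `kappa` at any enumeration of the set `S`. -/
noncomputable def setKappa {n : ℕ} (q : ℝ) (x : Fin n → ℝ) (S : Finset (Fin n)) : ℝ :=
  ∑ b ∈ S, x b * q ^ gap S b

/-- The increment `κ(S ∪ {c}) - q⁻¹ κ(S)`. -/
noncomputable def increment {n : ℕ} (q : ℝ) (x : Fin n → ℝ) (S : Finset (Fin n)) (c : Fin n) : ℝ :=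
  x c * q ^ gap S c + (1 - q⁻¹) * ∑ a ∈ S.filter (· < c), x a * q ^ gap S a

/-- The normalising factor attached to a set of letters. -/
noncomputable def setDenom {n : ℕ} (q : ℝ) (x : Fin n → ℝ) (S : Finset (Fin n)) : ℝ :=
  ∑ i, x i - setKappa q x S * q ^ S.card / q ^ n

/-! ### Increments of κ and the conditional probabilities -/

section Increment

variable {n : ℕ} {q : ℝ} {x : Fin n → ℝ} {S : Finset (Fin n)} {a c d : Fin n}

lemma gap_insert_of_le (h : a ≤ c) : gap (insert c S) a = gap S a := by
  unfold gap
  congr 1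
  ext e
  simp only [Finset.mem_filter, Finset.mem_compl, Finset.mem_insert, not_or]
  constructor
  · tauto
  · rintro ⟨h1, h2⟩
    exact ⟨⟨(h2.trans_le h).ne, h1⟩, h2⟩

lemma gap_insert_of_lt (hc : c ∉ S) (h : c < a) : gap S a = gap (insert c S) a + 1 := by
  unfold gap
  have : (Sᶜ).filter (· < a) = insert c (((insert c S)ᶜ).filter (· < a)) := by
    ext e
    simp only [Finset.mem_filter, Finset.mem_compl, Finset.mem_insert, not_or]
    by_cases he : e = c
    · subst he; tauto
    · tauto
  rw [this, Finset.card_insert_of_notMem (by simp)]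

lemma pow_gap_insert_of_lt (hq : q ≠ 0) (hc : c ∉ S) (h : c < a) :
    q ^ gap (insert c S) a = q⁻¹ * q ^ gap S a := by
  rw [gap_insert_of_lt hc h, pow_succ]
  field_simp

/-- Inserting `c` lowers the gap by one exactly for the letters above `c`. Those below keep their
weight, and their excess over the factor q⁻¹ goes into the increment. -/
lemma setKappa_insert (hq : q ≠ 0) (hc : c ∉ S) :
    setKappa q x (insert c S) = q⁻¹ * setKappa q x S + increment q x S c := by
  unfold setKappa increment
  rw [Finset.sum_insert hc, gap_insert_of_le le_rfl, Finset.sum_filter, Finset.mul_sum,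
    Finset.mul_sum, add_left_comm, ← Finset.sum_add_distrib]
  congr 1
  refine Finset.sum_congr rfl fun a ha => ?_
  have hac : a ≠ c := fun h => hc (h ▸ ha)
  split_ifs with h
  · rw [gap_insert_of_le h.le]; ring
  · rw [pow_gap_insert_of_lt hq hc (lt_of_le_of_ne (not_lt.1 h) hac.symm)]; ring

lemma increment_insert_of_lt (h : d < c) :
    increment q x (insert c S) d = increment q x S d := by
  unfold increment
  rw [gap_insert_of_le h.le, Finset.filter_insert, if_neg h.not_gt]
  congr 2
  refine Finset.sum_congr rfl fun a ha => ?_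
  rw [gap_insert_of_le ((Finset.mem_filter.1 ha).2.trans h).le]

/-- In the sum over letters below `d`, the new term at `c` and the excess of the letters below `c`
make up the increment at `c`. The coefficients `q` and `q - 1` match the Hecke generator at an
ascent. -/
lemma increment_insert_of_gt (hq : q ≠ 0) (hc : c ∉ S) (h : c < d) :
    q * increment q x (insert c S) d = increment q x S d + (q - 1) * increment q x S c := by
  unfold increment
  have h1 : ∑ a ∈ (insert c S).filter (· < d), x a * q ^ gap (insert c S) a
      = x c * q ^ gap S c + (q⁻¹ * ∑ a ∈ S.filter (· < d), x a * q ^ gap S a +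
        (1 - q⁻¹) * ∑ a ∈ S.filter (· < c), x a * q ^ gap S a) := by
    rw [Finset.filter_insert, if_pos h, Finset.sum_insert (by simp [hc]), gap_insert_of_le le_rfl]
    congr 1
    rw [Finset.sum_filter, Finset.sum_filter, Finset.sum_filter, Finset.mul_sum, Finset.mul_sum,
      ← Finset.sum_add_distrib]
    refine Finset.sum_congr rfl fun a ha => ?_
    have hac : a ≠ c := fun h => hc (h ▸ ha)
    rcases lt_or_gt_of_ne hac with h' | h'
    · rw [if_pos (h'.trans h), if_pos (h'.trans h), if_pos h', gap_insert_of_le h'.le]; ring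
    · rw [if_neg h'.not_gt, pow_gap_insert_of_lt hq hc h']
      split_ifs <;> ring
  rw [h1, pow_gap_insert_of_lt hq hc h]
  field_simp
  ring

lemma increment_pos (hq : 1 ≤ q) (hx : ∀ i, 0 < x i) : 0 < increment q x S c := by
  have h0 : 0 < q := by linarith
  have h1 : 0 ≤ 1 - q⁻¹ := sub_nonneg.2 (inv_le_one_of_one_le₀ hq)
  have h2 : 0 ≤ ∑ a ∈ S.filter (· < c), x a * q ^ gap S a :=
    Finset.sum_nonneg fun a _ => (mul_pos (hx a) (pow_pos h0 _)).le
  have h3 : 0 < x c * q ^ gap S c := mul_pos (hx c) (pow_pos h0 _)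
  unfold increment
  positivity

lemma increment_empty : increment q x ∅ c = x c * q ^ (c : ℕ) := by
  have h : (Finset.univ.filter (· < c)).card = (c : ℕ) := by
    rw [← Fin.card_Iio]; congr 1; ext; simp
  simp [increment, gap, h]

/-- The ranks in `U` run through 0, …, |U| − 1, so the sum is geometric. -/
lemma geom_sum_rank {α : Type*} [LinearOrder α] (q : ℝ) (U : Finset α) :
    (1 - q⁻¹) * ∑ c ∈ U, (q⁻¹) ^ (U.filter (· < c)).card = 1 - (q⁻¹) ^ U.card := by
  induction U using Finset.induction_on_max with
  | empty => simp
  | insert a s ha ih =>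
    have hn : a ∉ s := fun h => lt_irrefl _ (ha a h)
    have e1 : (insert a s).filter (· < a) = s := by
      rw [Finset.filter_insert, if_neg (lt_irrefl a), Finset.filter_true_of_mem ha]
    have e2 : ∑ c ∈ s, (q⁻¹) ^ ((insert a s).filter (· < c)).card
        = ∑ c ∈ s, (q⁻¹) ^ (s.filter (· < c)).card := by
      refine Finset.sum_congr rfl fun c hc => ?_
      rw [Finset.filter_insert, if_neg (ha c hc).not_gt]
    rw [Finset.sum_insert hn, e1, e2, Finset.card_insert_of_notMem hn, mul_add, ih]
    ring

/-- The missing letters above `a` have the consecutive gaps `gap S a`, …, |Sᶜ| − 1. -/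
lemma geom_sum_gap (ha : a ∈ S) :
    (1 - q⁻¹) * ∑ c ∈ (Sᶜ).filter (a < ·), (q⁻¹) ^ gap S c
      = (q⁻¹) ^ gap S a - (q⁻¹) ^ (Sᶜ).card := by
  have key : ∀ c ∈ (Sᶜ).filter (a < ·),
      gap S c = gap S a + (((Sᶜ).filter (a < ·)).filter (· < c)).card := by
    intro c hc
    have hac := (Finset.mem_filter.1 hc).2
    unfold gap
    rw [← Finset.card_union_of_disjoint]
    · congr 1
      ext e
      simp only [Finset.mem_filter, Finset.mem_union, Finset.mem_compl]
      constructor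
      · rintro ⟨h1, h2⟩
        rcases lt_trichotomy e a with h | h | h
        · tauto
        · exact absurd (h ▸ ha) h1
        · tauto
      · rintro (⟨h1, h2⟩ | ⟨⟨h1, h2⟩, h3⟩)
        · exact ⟨h1, h2.trans hac⟩
        · exact ⟨h1, h3⟩
    · rw [Finset.disjoint_left]
      intro e h1 h2
      simp only [Finset.mem_filter] at h1 h2
      exact lt_asymm h1.2 h2.1.2
  have hcard : (Sᶜ).card = gap S a + ((Sᶜ).filter (a < ·)).card := by
    unfold gap
    rw [← Finset.card_union_of_disjoint]
    · congr 1
      ext e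
      simp only [Finset.mem_filter, Finset.mem_union, Finset.mem_compl]
      constructor
      · intro h1
        rcases lt_trichotomy e a with h | h | h
        · tauto
        · exact absurd (h ▸ ha) h1
        · tauto
      · tauto
    · rw [Finset.disjoint_left]
      intro e h1 h2
      simp only [Finset.mem_filter] at h1 h2
      exact lt_asymm h1.2 h2.2
  rw [Finset.sum_congr rfl fun c hc => by rw [key c hc, pow_add], ← Finset.mul_sum,
    mul_left_comm, geom_sum_rank, hcard, pow_add]
  ring

/-- After exchanging the sums, the coefficient of each `x a` with `a ∈ S` is a geometric sum over
the missing letters above `a`. -/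
lemma sum_increment (hq : q ≠ 0) :
    ∑ c ∈ Sᶜ, increment q x S c / q ^ gap S c = setDenom q x S := by
  have e1 : ∀ c ∈ Sᶜ, increment q x S c / q ^ gap S c
      = x c + ∑ a ∈ S, x a * q ^ gap S a * ((1 - q⁻¹) * if a < c then (q⁻¹) ^ gap S c else 0) := by
    intro c _
    unfold increment
    rw [add_div, mul_div_cancel_right₀ _ (pow_ne_zero _ hq), Finset.sum_filter, Finset.mul_sum,
      Finset.sum_div]
    congr 1
    refine Finset.sum_congr rfl fun a _ => ?_
    split_ifs
    · rw [inv_pow]; ring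
    · simp
  have e2 : ∀ a ∈ S, ∑ c ∈ Sᶜ,
      x a * q ^ gap S a * ((1 - q⁻¹) * if a < c then (q⁻¹) ^ gap S c else 0)
        = x a - x a * q ^ gap S a * q ^ S.card / q ^ n := by
    intro a ha
    rw [← Finset.mul_sum, ← Finset.mul_sum, ← Finset.sum_filter, geom_sum_gap ha, mul_sub]
    have hn : q ^ n = q ^ S.card * q ^ (Sᶜ).card := by
      rw [← pow_add, Finset.card_add_card_compl, Fintype.card_fin]
    rw [hn, inv_pow, inv_pow]
    field_simp
  rw [Finset.sum_congr rfl e1, Finset.sum_add_distrib, Finset.sum_comm, Finset.sum_congr rfl e2,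
    Finset.sum_sub_distrib]
  unfold setDenom setKappa
  rw [← Finset.sum_compl_add_sum S, Finset.sum_mul, Finset.sum_div]
  ring

lemma setDenom_pos (hq : 1 ≤ q) (hx : ∀ i, 0 < x i) (hc : c ∉ S) : 0 < setDenom q x S := by
  have h0 : 0 < q := by linarith
  rw [← sum_increment h0.ne']
  exact Finset.sum_pos (fun a _ => div_pos (increment_pos hq hx) (pow_pos h0 _))
    ⟨c, Finset.mem_compl.2 hc⟩

lemma setDenom_insert (hq : q ≠ 0) (hc : c ∉ S) :
    setDenom q x (insert c S)
      = setDenom q x S - increment q x S c * q ^ (S.card + 1) / q ^ n := by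
  unfold setDenom
  rw [setKappa_insert hq hc, Finset.card_insert_of_notMem hc]
  field_simp
  ring

lemma setDenom_empty : setDenom q x ∅ = ∑ i, x i := by
  simp [setDenom, setKappa]

/-- The probability that the letter `c` follows a prefix with set of letters `S`. -/
noncomputable def condProb {n : ℕ} (q : ℝ) (x : Fin n → ℝ) (S : Finset (Fin n)) (c : Fin n) : ℝ :=
  increment q x S c / (q ^ gap S c * setDenom q x S)

lemma condProb_pos (hq : 1 ≤ q) (hx : ∀ i, 0 < x i) (hc : c ∉ S) : 0 < condProb q x S c :=
  div_pos (increment_pos hq hx)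
    (mul_pos (pow_pos (by linarith) _) (setDenom_pos hq hx hc))

lemma sum_condProb (hq : 1 ≤ q) (hx : ∀ i, 0 < x i) (hc : c ∉ S) :
    ∑ d ∈ Sᶜ, condProb q x S d = 1 := by
  have h0 : q ≠ 0 := by linarith
  simp only [condProb, ← div_div]
  rw [← Finset.sum_div, sum_increment h0, div_self (setDenom_pos hq hx hc).ne']

/-- Inserting the larger letter `c` does not affect the increment of `d`, so only the change of the
denominator in `setDenom_insert` matters. -/
lemma condProb_exchange_of_gt (hq : 1 ≤ q) (hx : ∀ i, 0 < x i) (hc : c ∉ S) (hd : d ∉ S)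
    (h : d < c) :
    condProb q x S c * condProb q x (insert c S) d
        + condProb q x S d * (q ^ n / (q ^ (S.card + 2) * q ^ gap (insert d S) c))
      = condProb q x (insert c S) d * (q ^ n / (q ^ (S.card + 1) * q ^ gap S c)) := by
  have h0 : q ≠ 0 := by linarith
  have hD := (setDenom_pos hq hx hc).ne'
  have hDc := (setDenom_pos hq hx (S := insert c S) (c := d) (by simp [hd, h.ne])).ne'
  have e := setDenom_insert (x := x) h0 hc
  unfold condProb
  rw [increment_insert_of_lt h, gap_insert_of_le h.le, pow_gap_insert_of_lt h0 hd h]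
  field_simp at e ⊢
  linear_combination (q ^ 2 * q ^ S.card * increment q x S d) * e

lemma condProb_exchange_of_lt (hq : 1 ≤ q) (hx : ∀ i, 0 < x i) (hc : c ∉ S) (hd : d ∉ S)
    (h : c < d) :
    condProb q x S c * condProb q x (insert c S) d
        + (q * (condProb q x S d * (q ^ n / (q ^ (S.card + 2) * q ^ gap (insert d S) c)))
        + (q - 1) * (condProb q x S c * (q ^ n / (q ^ (S.card + 2) * q ^ gap (insert c S) d))))
      = condProb q x (insert c S) d * (q ^ n / (q ^ (S.card + 1) * q ^ gap S c)) := by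
  have h0 : q ≠ 0 := by linarith
  have hD := (setDenom_pos hq hx hc).ne'
  have hDc := (setDenom_pos hq hx (S := insert c S) (c := d) (by simp [hd, h.ne'])).ne'
  have e := setDenom_insert (x := x) h0 hc
  have e' := increment_insert_of_gt (x := x) h0 hc h
  unfold condProb
  rw [gap_insert_of_le h.le, pow_gap_insert_of_lt h0 hc h]
  field_simp at e e' ⊢
  rw [← e']
  linear_combination (q ^ (S.card + 1) * q * increment q x (insert c S) d) * e

end Increment
-- Prefix probabilities and total mass
section Prefix

variable {n : ℕ} {q : ℝ} {x : Fin n → ℝ}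

/-- The set of the first `k` letters. -/
def prefixSet {n : ℕ} (π : Equiv.Perm (Fin n)) (k : ℕ) : Finset (Fin n) :=
  Finset.univ.filter (fun a => (π.symm a : ℕ) < k)

lemma apply_mem_prefixSet {π : Equiv.Perm (Fin n)} {k : ℕ} {i : Fin n} :
    π i ∈ prefixSet π k ↔ (i : ℕ) < k := by
  simp [prefixSet]

lemma prefixSet_zero (π : Equiv.Perm (Fin n)) : prefixSet π 0 = ∅ := by
  simp [prefixSet]

lemma prefixSet_succ (π : Equiv.Perm (Fin n)) (k : Fin n) :
    prefixSet π (k + 1) = insert (π k) (prefixSet π k) := by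
  ext a
  obtain ⟨i, rfl⟩ := π.surjective a
  rw [Finset.mem_insert, apply_mem_prefixSet, apply_mem_prefixSet, π.injective.eq_iff, Fin.ext_iff]
  omega

lemma apply_notMem_prefixSet (π : Equiv.Perm (Fin n)) (k : Fin n) : π k ∉ prefixSet π k := by
  simp [apply_mem_prefixSet]

lemma card_prefixSet (π : Equiv.Perm (Fin n)) {k : ℕ} (hk : k ≤ n) : (prefixSet π k).card = k := by
  induction k with
  | zero => simp [prefixSet_zero]
  | succ k ih =>
    have := prefixSet_succ π ⟨k, hk⟩
    simp only at this
    rw [this, Finset.card_insert_of_notMem (apply_notMem_prefixSet π ⟨k, hk⟩), ih (by omega)]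

lemma prefixSet_mul_swap (π : Equiv.Perm (Fin n)) {a b : Fin n} {k : ℕ}
    (h : (a : ℕ) < k ↔ (b : ℕ) < k) : prefixSet (π * Equiv.swap a b) k = prefixSet π k := by
  ext c
  obtain ⟨i, rfl⟩ := π.surjective c
  have e : π i = (π * Equiv.swap a b) (Equiv.swap a b i) := by simp
  rw [apply_mem_prefixSet, e, apply_mem_prefixSet]
  rcases eq_or_ne i a with rfl | ha
  · rw [Equiv.swap_apply_left, h]
  rcases eq_or_ne i b with rfl | hb
  · rw [Equiv.swap_apply_right, h]
  rw [Equiv.swap_apply_of_ne_of_ne ha hb]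

/-- The conditional probability of the letter at position `k` given the preceding ones. -/
noncomputable def stepProb {n : ℕ} (q : ℝ) (x : Fin n → ℝ) (k : Fin n)
    (π : Equiv.Perm (Fin n)) : ℝ :=
  condProb q x (prefixSet π k) (π k)

/-- The probability of the first `k` letters. -/
noncomputable def prefixProb {n : ℕ} (q : ℝ) (x : Fin n → ℝ) (k : ℕ)
    (π : Equiv.Perm (Fin n)) : ℝ :=
  ∏ j ∈ Finset.univ.filter (fun j : Fin n => (j : ℕ) < k), stepProb q x j π

lemma stepProb_pos (hq : 1 ≤ q) (hx : ∀ i, 0 < x i) (k : Fin n) (π : Equiv.Perm (Fin n)) :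
    0 < stepProb q x k π :=
  condProb_pos hq hx (apply_notMem_prefixSet π k)

lemma prefixProb_pos (hq : 1 ≤ q) (hx : ∀ i, 0 < x i) (k : ℕ) (π : Equiv.Perm (Fin n)) :
    0 < prefixProb q x k π :=
  Finset.prod_pos fun j _ => stepProb_pos hq hx j π

lemma prefixProb_zero (π : Equiv.Perm (Fin n)) : prefixProb q x 0 π = 1 := by
  simp [prefixProb]

lemma prefixProb_succ (k : Fin n) (π : Equiv.Perm (Fin n)) :
    prefixProb q x (k + 1) π = prefixProb q x k π * stepProb q x k π := by
  have e : Finset.univ.filter (fun j : Fin n => (j : ℕ) < k + 1)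
      = insert k (Finset.univ.filter (fun j : Fin n => (j : ℕ) < k)) := by
    ext j
    simp only [Finset.mem_filter, Finset.mem_univ, true_and, Finset.mem_insert, Fin.ext_iff]
    omega
  rw [prefixProb, e, Finset.prod_insert (by simp), mul_comm, prefixProb]

lemma stepProb_mul_swap (π : Equiv.Perm (Fin n)) {a b k : Fin n} (ha : a < k) (hb : b < k) :
    stepProb q x k (π * Equiv.swap a b) = stepProb q x k π := by
  unfold stepProb
  rw [prefixSet_mul_swap π (iff_of_true ha hb), Equiv.Perm.mul_apply,
    Equiv.swap_apply_of_ne_of_ne ha.ne' hb.ne']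

lemma prefixProb_mul_swap (π : Equiv.Perm (Fin n)) {a b : Fin n} {k : ℕ} (ha : k ≤ a)
    (hb : k ≤ b) : prefixProb q x k (π * Equiv.swap a b) = prefixProb q x k π := by
  refine Finset.prod_congr rfl fun j hj => ?_
  have hj' : (j : ℕ) < k := (Finset.mem_filter.1 hj).2
  unfold stepProb
  rw [prefixSet_mul_swap π (by omega), Equiv.Perm.mul_apply,
    Equiv.swap_apply_of_ne_of_ne (by rw [ne_eq, Fin.ext_iff]; omega)
      (by rw [ne_eq, Fin.ext_iff]; omega)]

lemma sum_stepProb_mul_swap (hq : 1 ≤ q) (hx : ∀ i, 0 < x i) (π : Equiv.Perm (Fin n))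
    (k : Fin n) :
    ∑ j ∈ Finset.univ.filter (fun j : Fin n => k ≤ j), stepProb q x k (π * Equiv.swap k j) = 1 := by
  rw [← sum_condProb hq hx (apply_notMem_prefixSet π k)]
  refine Finset.sum_bij (fun j _ => π j) ?_ ?_ ?_ ?_
  · intro j hj
    rw [Finset.mem_compl, apply_mem_prefixSet]
    exact not_lt.2 (Finset.mem_filter.1 hj).2
  · intro i _ j _ h
    exact π.injective h
  · intro b hb
    obtain ⟨i, rfl⟩ := π.surjective b
    rw [Finset.mem_compl, apply_mem_prefixSet] at hb
    exact ⟨i, by simpa using hb, rfl⟩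
  · intro j hj
    have hkj : (k : ℕ) ≤ j := (Finset.mem_filter.1 hj).2
    unfold stepProb
    rw [prefixSet_mul_swap π (by omega), Equiv.Perm.mul_apply, Equiv.swap_apply_left]

/-- Swapping positions `k` and `j ≥ k` permutes the summands and fixes the first `k` letters. As `j`
varies, each unused letter comes to position `k` once. -/
lemma sum_prefixProb_succ (hq : 1 ≤ q) (hx : ∀ i, 0 < x i) (k : Fin n) :
    ((n - k : ℕ) : ℝ) * ∑ π, prefixProb q x (k + 1) π = ∑ π, prefixProb q x k π := by
  have hcard : (Finset.univ.filter (fun j : Fin n => k ≤ j)).card = n - k := by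
    rw [← Fin.card_Ici]; congr 1; ext; simp
  have e : ∀ j ∈ Finset.univ.filter (fun j : Fin n => k ≤ j),
      ∑ π, prefixProb q x (k + 1) π
        = ∑ π, prefixProb q x k π * stepProb q x k (π * Equiv.swap k j) := by
    intro j hj
    have hkj : (k : ℕ) ≤ j := (Finset.mem_filter.1 hj).2
    rw [← Equiv.sum_comp (Equiv.mulRight (Equiv.swap k j))]
    refine Finset.sum_congr rfl fun π _ => ?_
    rw [Equiv.coe_mulRight, prefixProb_succ, prefixProb_mul_swap π le_rfl hkj]
  rw [← hcard, ← nsmul_eq_mul, ← Finset.sum_const, Finset.sum_congr rfl e, Finset.sum_comm]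
  refine Finset.sum_congr rfl fun π _ => ?_
  rw [← Finset.mul_sum, sum_stepProb_mul_swap hq hx, mul_one]

lemma sum_prefixProb (hq : 1 ≤ q) (hx : ∀ i, 0 < x i) : ∑ π, prefixProb q x n π = 1 := by
  -- A prefix of length `k` has (n − k)! completions, each counted in the sum over permutations.
  have key : ∀ k ≤ n, ((n - k).factorial : ℝ) = ∑ π, prefixProb q x k π := by
    intro k
    induction k with
    | zero => intro _; simp [prefixProb_zero, Fintype.card_perm]
    | succ k ih =>
      intro hk
      have h1 := sum_prefixProb_succ hq hx (⟨k, hk⟩ : Fin n)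
      have h2 : n - k = (n - (k + 1)) + 1 := by omega
      simp only at h1
      rw [← ih (by omega), h2, Nat.factorial_succ, Nat.cast_mul] at h1
      exact (mul_left_cancel₀ (by positivity) h1).symm
  simpa using (key n le_rfl).symm

lemma stepProb_last (hq : 1 ≤ q) (hx : ∀ i, 0 < x i) (k : Fin n) (hk : (k : ℕ) + 1 = n)
    (π : Equiv.Perm (Fin n)) : stepProb q x k π = 1 := by
  have h := sum_stepProb_mul_swap hq hx π k
  have e : Finset.univ.filter (fun j : Fin n => k ≤ j) = {k} := by
    ext j
    simp only [Finset.mem_filter, Finset.mem_univ, true_and, Finset.mem_singleton, Fin.ext_iff,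
      Fin.le_def]
    omega
  rw [e, Finset.sum_singleton, Equiv.swap_self] at h
  exact h

lemma gap_prefixSet_last (k : Fin n) (hk : (k : ℕ) + 1 = n) (π : Equiv.Perm (Fin n)) :
    gap (prefixSet π k) (π k) = 0 := by
  rw [gap, Finset.card_eq_zero, Finset.filter_eq_empty_iff]
  intro e he
  obtain ⟨i, rfl⟩ := π.surjective e
  rw [Finset.mem_compl, apply_mem_prefixSet] at he
  have : i = k := by rw [Fin.ext_iff]; omega
  rw [this]
  exact lt_irrefl _

end Prefix

/-! ### The operators in coordinates -/

section Operators

variable {n : ℕ} {q : ℝ}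

/-- The Hecke generator in coordinates. -/
noncomputable def coordT {n : ℕ} (q : ℝ) (a b : Fin n) :
    (Equiv.Perm (Fin n) → ℝ) →ₗ[ℝ] (Equiv.Perm (Fin n) → ℝ) where
  toFun F := fun σ =>
    if σ a < σ b then q * F (σ * Equiv.swap a b) + (q - 1) * F σ else F (σ * Equiv.swap a b)
  map_add' F G := by
    funext σ
    simp only [Pi.add_apply]
    split_ifs <;> ring
  map_smul' r F := by
    funext σ
    simp only [Pi.smul_apply, smul_eq_mul, RingHom.id_apply]
    split_ifs <;> ring

lemma coordT_apply (a b : Fin n) (F : Equiv.Perm (Fin n) → ℝ) (σ : Equiv.Perm (Fin n)) :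
    coordT q a b F σ = if σ a < σ b then q * F (σ * Equiv.swap a b) + (q - 1) * F σ
      else F (σ * Equiv.swap a b) := rfl

/-- The operator `T_m ⋯ T_1` in coordinates. -/
noncomputable def coordDescend {n : ℕ} (q : ℝ) :
    (m : ℕ) → m < n → ((Equiv.Perm (Fin n) → ℝ) →ₗ[ℝ] (Equiv.Perm (Fin n) → ℝ))
  | 0, _ => LinearMap.id
  | m + 1, h => (coordDescend q m (Nat.lt_of_succ_lt h)).comp
      (coordT q ⟨m, Nat.lt_of_succ_lt h⟩ ⟨m + 1, h⟩)

lemma heckeT_apply (i : ℕ) (h : i + 1 < n) (F : PermSpace n) :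
    ⇑(heckeT q i h F) = coordT q ⟨i, Nat.lt_of_succ_lt h⟩ ⟨i + 1, h⟩ ⇑F := by
  induction F using Finsupp.induction_linear with
  | zero => rw [map_zero, Finsupp.coe_zero, map_zero]
  | add F G hF hG => rw [map_add, Finsupp.coe_add, Finsupp.coe_add, map_add, hF, hG]
  | single π r =>
    funext σ
    unfold heckeT
    rw [Finsupp.linearCombination_single, coordT_apply]
    set a : Fin n := ⟨i, Nat.lt_of_succ_lt h⟩
    set b : Fin n := ⟨i + 1, h⟩
    have hab : a ≠ b := by simp [a, b, Fin.ext_iff]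
    by_cases h1 : σ = π
    · subst h1
      have h2 : σ * Equiv.swap a b ≠ σ := by simp [Equiv.swap_eq_one_iff, hab]
      rcases lt_or_gt_of_ne (σ.injective.ne hab) with h3 | h3
      · simp [h3, h3.not_gt, h2, h2.symm]; ring
      · simp [h3, h3.not_gt, h2, h2.symm]
    · by_cases h2 : σ = π * Equiv.swap a b
      · subst h2
        rcases lt_or_gt_of_ne (π.injective.ne hab) with h3 | h3
        · simp [h3.not_gt, Ne.symm h1, mul_assoc]
        · simp [h3, Ne.symm h1, mul_assoc]; ring
      · have h3 : π ≠ σ * Equiv.swap a b := by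
          rintro rfl; exact h2 (by simp [mul_assoc])
        simp only [Finsupp.single_apply, Finsupp.smul_apply, if_neg h3, if_neg (Ne.symm h1)]
        split_ifs <;> simp [Ne.symm h1, Ne.symm h2]

lemma heckeDescend_apply (m : ℕ) (h : m < n) (F : PermSpace n) :
    ⇑(heckeDescend q m h F) = coordDescend q m h ⇑F := by
  induction m generalizing F with
  | zero => rfl
  | succ m ih =>
    rw [heckeDescend, LinearMap.comp_apply, ih, heckeT_apply]
    rfl

lemma heckeSum_apply (F : PermSpace n) (σ : Equiv.Perm (Fin n)) :
    heckeSum n q F σ = ∑ m : Fin n, coordDescend q m m.isLt ⇑F σ := by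
  simp [heckeSum, ← heckeDescend_apply, Finsupp.finsetSum_apply]

lemma weightX_apply [NeZero n] (x : Fin n → ℝ) (F : PermSpace n) (σ : Equiv.Perm (Fin n)) :
    weightX q x F σ = x (σ 0) / q ^ (n - ((σ 0 : ℕ) + 1)) * F σ := by
  induction F using Finsupp.induction_linear with
  | zero => simp
  | add F G hF hG => rw [map_add, Finsupp.add_apply, Finsupp.add_apply, hF, hG, mul_add]
  | single π r =>
    unfold weightX
    rw [Finsupp.linearCombination_single]
    by_cases h : π = σ
    · subst h; simp [mul_comm]
    · simp [h]

lemma qTsetlin_apply [NeZero n] (x : Fin n → ℝ) (F : PermSpace n) (σ : Equiv.Perm (Fin n)) :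
    qTsetlin q x F σ = x (σ 0) / q ^ (n - ((σ 0 : ℕ) + 1)) *
      ∑ m : Fin n, coordDescend q m m.isLt ⇑F σ := by
  rw [qTsetlin, LinearMap.comp_apply, weightX_apply, heckeSum_apply]

/-- T_m ⋯ T_1 only mixes words that differ by transpositions of the first m + 1 positions, so an
invariant function acts as a scalar. -/
lemma coordDescend_mul_of_invariant (m : ℕ) (h : m < n) {p : Equiv.Perm (Fin n) → ℝ}
    (hp : ∀ (a b : Fin n), (a : ℕ) ≤ m → (b : ℕ) ≤ m → ∀ σ, p (σ * Equiv.swap a b) = p σ)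
    (F : Equiv.Perm (Fin n) → ℝ) :
    coordDescend q m h (p * F) = p * coordDescend q m h F := by
  induction m generalizing F with
  | zero => rfl
  | succ m ih =>
    have e : coordT q ⟨m, Nat.lt_of_succ_lt h⟩ ⟨m + 1, h⟩ (p * F)
        = p * coordT q ⟨m, Nat.lt_of_succ_lt h⟩ ⟨m + 1, h⟩ F := by
      funext σ
      simp only [Pi.mul_apply, coordT_apply]
      rw [hp ⟨m, Nat.lt_of_succ_lt h⟩ ⟨m + 1, h⟩ (Nat.le_succ m) le_rfl σ]
      split_ifs <;> ring
    rw [coordDescend, LinearMap.comp_apply, LinearMap.comp_apply, e,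
      ih _ (fun a b ha hb => hp a b (by omega) (by omega))]

end Operators

/-! ### The eigenvector equation -/

section Eigenvector

variable {n : ℕ} {q : ℝ} {x : Fin n → ℝ}

/-- The weight of a prefix of length `k` that is followed by a prescribed letter which
`q`-random-to-top brings from an arbitrary later position to position `k`. -/
noncomputable def insertWeight {n : ℕ} (q : ℝ) (x : Fin n → ℝ) (k : Fin n)
    (π : Equiv.Perm (Fin n)) : ℝ :=
  prefixProb q x k π * (q ^ n / (q ^ ((k : ℕ) + 1) * q ^ gap (prefixSet π k) (π k)))

/-- With the common prefix probability factored out, this is an identity between two adjacent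
letters: `condProb_exchange_of_lt` at an ascent, `condProb_exchange_of_gt` at a descent. -/
lemma prefixProb_exchange (hq : 1 ≤ q) (hx : ∀ i, 0 < x i) (k l : Fin n)
    (hkl : (l : ℕ) = k + 1) :
    prefixProb q x (l + 1) + coordT q k l (insertWeight q x l)
      = stepProb q x l * insertWeight q x k := by
  funext π
  have hlt : k < l := by rw [Fin.lt_def]; omega
  have hne : k ≠ l := hlt.ne
  set S := prefixSet π k with hS
  set c := π k with hc
  set d := π l with hd
  have hcS : c ∉ S := apply_notMem_prefixSet π k
  have hdS : d ∉ S := by rw [hS, hd, apply_mem_prefixSet]; omega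
  have hSl : prefixSet π l = insert c S := by rw [hkl, prefixSet_succ]
  have hSk' : prefixSet (π * Equiv.swap k l) k = S := prefixSet_mul_swap π (by omega)
  have hSl' : prefixSet (π * Equiv.swap k l) l = insert d S := by
    rw [hkl, prefixSet_succ, hSk', Equiv.Perm.mul_apply, Equiv.swap_apply_left]
  have hcard : S.card = k := card_prefixSet π k.isLt.le
  have e1 : ∀ σ : Equiv.Perm (Fin n),
      prefixProb q x l σ = prefixProb q x k σ * stepProb q x k σ := fun σ => by
    rw [hkl, prefixProb_succ]
  simp only [Pi.add_apply, Pi.mul_apply, coordT_apply, insertWeight, prefixProb_succ, e1,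
    stepProb, hSk', hSl, hSl', ← hS, ← hc, ← hd, prefixProb_mul_swap π (le_refl (k : ℕ)) hlt.le,
    Equiv.Perm.mul_apply, Equiv.swap_apply_left, Equiv.swap_apply_right]
  rw [hkl, ← hcard]
  rcases lt_or_gt_of_ne (π.injective.ne hne) with h | h
  · rw [if_pos h]
    linear_combination prefixProb q x S.card π * condProb_exchange_of_lt hq hx hcS hdS h
  · rw [if_neg h.not_gt]
    linear_combination prefixProb q x S.card π * condProb_exchange_of_gt hq hx hcS hdS h

/-- The right-hand side is the eigenvalue times the prefix probability, divided by the weight of 𝒳.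
The `insertWeight` term is the correction that makes induction on the prefix length possible. -/
lemma sum_coordDescend_prefixProb [NeZero n] (hq : 1 ≤ q) (hx : ∀ i, 0 < x i) (k : ℕ)
    (hk : k < n) :
    (∑ m : Fin k, coordDescend q m (m.isLt.trans hk) (prefixProb q x (k + 1)))
        + coordDescend q k hk (insertWeight q x ⟨k, hk⟩)
      = (fun π => (∑ i, x i) * (q ^ n / q ^ ((π 0 : ℕ) + 1)) / x (π 0))
        * prefixProb q x (k + 1) := by
  have h0 : q ≠ 0 := by linarith
  induction k with
  | zero =>
    funext π
    have e0 : π ⟨0, hk⟩ = π 0 := rfl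
    have hX : ∑ i, x i ≠ 0 := (Finset.sum_pos (fun i _ => hx i) ⟨0, Finset.mem_univ _⟩).ne'
    have hx0 := (hx (π 0)).ne'
    have h1 := prefixProb_succ (q := q) (x := x) ⟨0, hk⟩ π
    simp only [zero_add, prefixProb_zero, one_mul] at h1
    have hg : gap ∅ (π 0) = (π 0 : ℕ) := by
      rw [gap, ← Fin.card_Iio]; congr 1; ext; simp
    simp only [Finset.univ_eq_empty, Finset.sum_empty, zero_add, coordDescend,
      LinearMap.id_apply, Pi.mul_apply, h1, insertWeight, stepProb, condProb,
      prefixProb_zero, prefixSet_zero, e0, setDenom_empty, increment_empty, hg]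
    field_simp
    ring
  | succ k ih =>
    have hk' : k < n := by omega
    have hex := prefixProb_exchange hq hx ⟨k, hk'⟩ ⟨k + 1, hk⟩ rfl
    have hinv : ∀ m ≤ k, ∀ (a b : Fin n), (a : ℕ) ≤ m → (b : ℕ) ≤ m → ∀ σ,
        stepProb q x ⟨k + 1, hk⟩ (σ * Equiv.swap a b) = stepProb q x ⟨k + 1, hk⟩ σ := by
      intro m hm a b ha hb σ
      exact stepProb_mul_swap σ (by rw [Fin.lt_def]; simp only; omega)
        (by rw [Fin.lt_def]; simp only; omega)
    have hsplit : prefixProb q x (k + 1 + 1) = stepProb q x ⟨k + 1, hk⟩ * prefixProb q x (k + 1) := by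
      funext π
      rw [Pi.mul_apply, mul_comm]
      exact prefixProb_succ ⟨k + 1, hk⟩ π
    have hstep : coordDescend q (k + 1) hk (insertWeight q x ⟨k + 1, hk⟩)
        = coordDescend q k hk' (coordT q ⟨k, hk'⟩ ⟨k + 1, hk⟩ (insertWeight q x ⟨k + 1, hk⟩)) := rfl
    -- The last summand and the correction merge by the exchange identity. The probability of the
    -- new letter then factors out of every term, leaving the induction hypothesis.
    rw [Fin.sum_univ_castSucc, hstep, add_assoc]
    simp only [Fin.val_castSucc, Fin.val_last]
    rw [← map_add, hex, coordDescend_mul_of_invariant k hk' (hinv k le_rfl), hsplit,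
      Finset.sum_congr rfl fun (m : Fin k) _ =>
        coordDescend_mul_of_invariant m (m.isLt.trans hk') (hinv m m.isLt.le) _,
      ← Finset.mul_sum, ← mul_add, ih hk']
    ring

lemma sum_coordDescend_prefixProb_full [NeZero n] (hq : 1 ≤ q) (hx : ∀ i, 0 < x i)
    (π : Equiv.Perm (Fin n)) :
    x (π 0) / q ^ (n - ((π 0 : ℕ) + 1)) *
        ∑ m : Fin n, coordDescend q m m.isLt (prefixProb q x n) π
      = (∑ i, x i) * prefixProb q x n π := by
  have h0 : q ≠ 0 := by linarith
  obtain ⟨k, rfl⟩ : ∃ k, n = k + 1 := ⟨n - 1, by have := NeZero.pos n; omega⟩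
  have h := congrFun (sum_coordDescend_prefixProb hq hx k (Nat.lt_succ_self k)) π
  -- The last letter is forced: its step probability is 1 and its gap is 0.
  have hins : insertWeight q x ⟨k, Nat.lt_succ_self k⟩ = prefixProb q x (k + 1) := by
    funext σ
    have h1 := prefixProb_succ (q := q) (x := x) (⟨k, Nat.lt_succ_self k⟩ : Fin (k + 1)) σ
    rw [stepProb_last hq hx _ rfl, mul_one] at h1
    have hg : gap (prefixSet σ k) (σ ⟨k, Nat.lt_succ_self k⟩) = 0 :=
      gap_prefixSet_last ⟨k, Nat.lt_succ_self k⟩ rfl σ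
    rw [insertWeight, hg]
    simp only at h1
    rw [h1]
    field_simp
  rw [hins] at h
  rw [Fin.sum_univ_castSucc]
  simp only [Pi.add_apply, Finset.sum_apply, Pi.mul_apply] at h
  simp only [Fin.val_castSucc, Fin.val_last]
  rw [h]
  have hpow : q ^ (k + 1) = q ^ (k + 1 - ((π 0 : ℕ) + 1)) * q ^ ((π 0 : ℕ) + 1) := by
    rw [← pow_add]; congr 1; have := (π 0).isLt; omega
  have hx0 := (hx (π 0)).ne'
  rw [hpow]
  field_simp

end Eigenvector

/-! ### Uniqueness by positivity -/

section Uniqueness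

variable {n : ℕ} {q : ℝ} {x : Fin n → ℝ}

/-- The cycle that moves the entry at position `m` to the front. -/
def frontCycle {n : ℕ} : (m : ℕ) → m < n → Equiv.Perm (Fin n)
  | 0, _ => 1
  | m + 1, h => frontCycle m (Nat.lt_of_succ_lt h) *
      Equiv.swap ⟨m, Nat.lt_of_succ_lt h⟩ ⟨m + 1, h⟩

lemma apply_mul_swap_le_coordT (hq : 1 ≤ q) {F : Equiv.Perm (Fin n) → ℝ} (hF : ∀ π, 0 ≤ F π)
    (a b : Fin n) (σ : Equiv.Perm (Fin n)) : F (σ * Equiv.swap a b) ≤ coordT q a b F σ := by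
  rw [coordT_apply]
  split_ifs
  · nlinarith [hF σ, hF (σ * Equiv.swap a b), mul_nonneg (sub_nonneg.2 hq) (hF σ),
      mul_nonneg (sub_nonneg.2 hq) (hF (σ * Equiv.swap a b))]
  · exact le_rfl

/-- Keep only the term in which every generator swaps: its coefficient is at least 1, and the other
terms are nonnegative because `q ≥ 1`. -/
lemma apply_mul_frontCycle_le_coordDescend (hq : 1 ≤ q) (m : ℕ) (h : m < n)
    {F : Equiv.Perm (Fin n) → ℝ} (hF : ∀ π, 0 ≤ F π) (σ : Equiv.Perm (Fin n)) :
    F (σ * frontCycle m h) ≤ coordDescend q m h F σ := by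
  induction m generalizing F with
  | zero => simp [frontCycle, coordDescend]
  | succ m ih =>
    have h1 := fun π => apply_mul_swap_le_coordT hq hF ⟨m, Nat.lt_of_succ_lt h⟩ ⟨m + 1, h⟩ π
    rw [frontCycle, coordDescend, LinearMap.comp_apply, ← mul_assoc]
    exact (h1 _).trans (ih _ fun π => (hF _).trans (h1 π))

/-- Quotients of consecutive front cycles are the adjacent transpositions. Inverses stay in the
submonoid because they are powers in a finite group. -/
lemma submonoid_eq_top_of_frontCycle_mem (H : Submonoid (Equiv.Perm (Fin n)))
    (hH : ∀ m (h : m < n), frontCycle m h ∈ H) : H = ⊤ := by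
  rcases n with _ | n
  · exact eq_top_iff.2 fun g _ => by rw [Subsingleton.elim g 1]; exact H.one_mem
  rw [eq_top_iff, ← Equiv.Perm.mclosure_swap_castSucc_succ, Submonoid.closure_le]
  rintro _ ⟨i, rfl⟩
  have h1 : (frontCycle (i : ℕ) (i.isLt.trans (Nat.lt_succ_self n)))⁻¹ *
      frontCycle ((i : ℕ) + 1) (Nat.succ_lt_succ i.isLt) = Equiv.swap i.castSucc i.succ := by
    rw [frontCycle, inv_mul_cancel_left]
    rfl
  have h2 : ∀ g ∈ H, g⁻¹ ∈ H := fun g hg => by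
    have : g⁻¹ = g ^ (orderOf g - 1) := by
      rw [inv_eq_iff_mul_eq_one, ← pow_succ', Nat.sub_add_cancel (orderOf_pos g),
        pow_orderOf_eq_one]
    rw [this]
    exact H.pow_mem hg _
  change Equiv.swap i.castSucc i.succ ∈ H
  rw [← h1]
  exact H.mul_mem (h2 _ (hH _ _)) (hH _ _)

/-- At a zero of `F` the eigenvector equation is a vanishing sum of nonnegative terms, so `F`
vanishes at every front-cycle translate as well. The front cycles generate the whole group. -/
lemma eq_zero_of_eigenvector [NeZero n] (hq : 1 ≤ q) (hx : ∀ i, 0 < x i) {t : ℝ}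
    {F : Equiv.Perm (Fin n) → ℝ} (hF : ∀ π, 0 ≤ F π)
    (hE : ∀ σ, x (σ 0) / q ^ (n - ((σ 0 : ℕ) + 1)) *
      ∑ m : Fin n, coordDescend q m m.isLt F σ = t * F σ)
    {π : Equiv.Perm (Fin n)} (hπ : F π = 0) (σ : Equiv.Perm (Fin n)) : F σ = 0 := by
  have h0 : 0 < q := by linarith
  let H : Submonoid (Equiv.Perm (Fin n)) :=
    { carrier := {g | ∀ σ, F σ = 0 → F (σ * g) = 0}
      one_mem' := fun σ hσ => by rwa [mul_one]
      mul_mem' := fun {a b} ha hb σ hσ => by rw [← mul_assoc]; exact hb _ (ha _ hσ) }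
  have hH : H = ⊤ := by
    refine submonoid_eq_top_of_frontCycle_mem H fun m h σ hσ => ?_
    have h1 := hE σ
    rw [hσ, mul_zero] at h1
    have h2 := (mul_eq_zero.1 h1).resolve_left (div_pos (hx _) (pow_pos h0 _)).ne'
    have h3 := fun k : Fin n => apply_mul_frontCycle_le_coordDescend hq k k.isLt hF σ
    have h4 := (Finset.sum_eq_zero_iff_of_nonneg fun k _ => (hF _).trans (h3 k)).1 h2
      ⟨m, h⟩ (Finset.mem_univ _)
    exact le_antisymm ((h3 ⟨m, h⟩).trans h4.le) (hF _)
  have h5 : π⁻¹ * σ ∈ H := hH ▸ Submonoid.mem_top _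
  have h6 := h5 π hπ
  rwa [mul_inv_cancel_left] at h6

lemma isStationaryDistribution_iff [NeZero n] (hq : 1 ≤ q) (hx : ∀ i, 0 < x i)
    (Ψ : PermSpace n) :
    IsStationaryDistribution q x Ψ ↔ ∀ π, Ψ π = prefixProb q x n π := by
  constructor
  · rintro ⟨hnn, hsum, heig⟩
    have hpos := prefixProb_pos (n := n) hq hx n
    -- The minimal ratio `t` keeps `Ψ - t • prefixProb q x n` nonnegative and makes it vanish at
    -- `π`.
    obtain ⟨π, -, hπ⟩ := Finset.exists_min_image Finset.univ
      (fun π => Ψ π / prefixProb q x n π) ⟨1, Finset.mem_univ _⟩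
    set t := Ψ π / prefixProb q x n π with ht
    have hF : ∀ σ, (⇑Ψ - t • prefixProb q x n) σ = 0 := by
      refine eq_zero_of_eigenvector (t := ∑ i, x i) (π := π) hq hx (fun σ => ?_) (fun σ => ?_) ?_
      · rw [Pi.sub_apply, Pi.smul_apply, smul_eq_mul, sub_nonneg, ← le_div_iff₀ (hpos σ)]
        exact hπ σ (Finset.mem_univ _)
      · have h1 := sum_coordDescend_prefixProb_full hq hx σ
        have h2 := DFunLike.congr_fun heig σ
        rw [qTsetlin_apply, Finsupp.smul_apply, smul_eq_mul] at h2
        simp only [map_sub, map_smul, Pi.sub_apply, Pi.smul_apply, smul_eq_mul,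
          Finset.sum_sub_distrib, ← Finset.mul_sum]
        linear_combination h2 - t * h1
      · rw [Pi.sub_apply, Pi.smul_apply, smul_eq_mul, ht, div_mul_cancel₀ _ (hpos π).ne', sub_self]
    have hF' : ∀ σ, Ψ σ = t * prefixProb q x n σ := fun σ => by
      simpa [sub_eq_zero] using hF σ
    have h1 : t = 1 := by
      rw [Finset.sum_congr rfl fun σ _ => hF' σ, ← Finset.mul_sum, sum_prefixProb hq hx,
        mul_one] at hsum
      exact hsum
    intro σ
    rw [hF', h1, one_mul]
  · intro h
    have hΨ : ⇑Ψ = prefixProb q x n := funext h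
    refine ⟨fun π => ?_, ?_, ?_⟩
    · rw [h]; exact (prefixProb_pos hq hx n π).le
    · rw [hΨ]; exact sum_prefixProb hq hx
    · ext σ
      rw [qTsetlin_apply, Finsupp.smul_apply, smul_eq_mul, hΨ,
        sum_coordDescend_prefixProb_full hq hx]

end Uniqueness

/-! ### Identification with the product formula -/

section Formula

variable {n : ℕ} {q : ℝ} {x : Fin n → ℝ}

lemma gap_add_card_filter (S : Finset (Fin n)) (a : Fin n) :
    gap S a + (S.filter (· < a)).card = a := by
  unfold gap
  rw [← Finset.card_union_of_disjoint, ← Finset.filter_union, Finset.union_comm,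
    Finset.union_compl, ← Fin.card_Iio]
  · congr 1; ext; simp
  · exact Finset.disjoint_filter_filter (disjoint_compl_left)

lemma card_filter_lt_get {c : List (Fin n)} (hc : c.Pairwise (· > ·)) (i : Fin c.length) :
    (c.toFinset.filter (· < c.get i)).card + i + 1 = c.length := by
  have hanti : StrictAnti c.get := fun i j h => List.pairwise_iff_get.1 hc i j h
  have e : c.toFinset.filter (· < c.get i) = (Finset.Ioi i).image c.get := by
    ext a
    simp only [Finset.mem_filter, List.mem_toFinset, Finset.mem_image, Finset.mem_Ioi]
    constructor
    · rintro ⟨h1, h2⟩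
      obtain ⟨j, rfl⟩ := List.mem_iff_get.1 h1
      exact ⟨j, hanti.lt_iff_gt.1 h2, rfl⟩
    · rintro ⟨j, h1, rfl⟩
      exact ⟨List.get_mem _ _, hanti h1⟩
  rw [e, Finset.card_image_of_injective _ hanti.injective, Fin.card_Ioi]
  omega

/-- In decreasing order, k − i entries lie below b_i, out of the b_i − 1 letters below it. The
exponent i + b_i − k − 1 therefore counts the missing ones. -/
lemma kappa_eq_setKappa {b : List (Fin n)} (hb : b.Nodup) :
    kappa q x b = setKappa q x b.toFinset := by
  unfold kappa
  have hperm := List.perm_insertionSort (fun a a' : Fin n => a ≥ a') b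
  have hsort := List.pairwise_insertionSort (fun a a' : Fin n => a ≥ a') b
  set c := b.insertionSort (fun a a' => a ≥ a')
  have hnd : c.Nodup := hperm.nodup_iff.2 hb
  have hgt : c.Pairwise (· > ·) :=
    (hsort.and hnd).imp fun h => lt_of_le_of_ne h.1 h.2.symm
  rw [← List.toFinset_eq_of_perm _ _ hperm, setKappa,
    List.sum_toFinset (fun a => x a * q ^ gap c.toFinset a) hnd]
  rw [← Fin.sum_univ_fun_getElem]
  refine Finset.sum_congr rfl fun i _ => ?_
  have h1 := card_filter_lt_get hgt i
  have h2 := gap_add_card_filter c.toFinset (c.get i)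
  have h3 : ((((i : ℕ) : ℤ) + 1) + (((c.get i : ℕ) : ℤ) + 1) - (c.length : ℤ) - 1)
      = (gap c.toFinset (c.get i) : ℤ) := by omega
  rw [h3, zpow_natCast]
  rfl

lemma nodup_word (π : Equiv.Perm (Fin n)) : (word π).Nodup :=
  List.nodup_ofFn.2 π.injective

lemma mem_drop_take_word {π : Equiv.Perm (Fin n)} {k p : ℕ} {i : Fin n} :
    π i ∈ ((word π).take k).drop p ↔ p ≤ i ∧ (i : ℕ) < k := by
  rw [List.mem_iff_getElem]
  simp only [word, List.getElem_drop, List.getElem_take, List.getElem_ofFn, List.length_drop,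
    List.length_take, List.length_ofFn, π.injective.eq_iff, Fin.ext_iff]
  constructor
  · rintro ⟨j, h, h'⟩
    omega
  · rintro ⟨h1, h2⟩
    exact ⟨i - p, by have := i.isLt; omega, by omega⟩

lemma toFinset_take_word (π : Equiv.Perm (Fin n)) (k : ℕ) :
    ((word π).take k).toFinset = prefixSet π k := by
  ext a
  obtain ⟨i, rfl⟩ := π.surjective a
  rw [List.mem_toFinset, apply_mem_prefixSet]
  simpa using mem_drop_take_word (π := π) (k := k) (p := 0) (i := i)

/-- For `a ≤ c`, the gap at `a` is determined by the elements of the set below `c`. -/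
lemma increment_congr {S S' : Finset (Fin n)} {c : Fin n}
    (h : S.filter (· < c) = S'.filter (· < c)) : increment q x S c = increment q x S' c := by
  have hg : ∀ a ≤ c, gap S a = gap S' a := by
    intro a ha
    have e : S.filter (· < a) = S'.filter (· < a) := by
      ext b
      have := Finset.ext_iff.1 h b
      simp only [Finset.mem_filter] at this ⊢
      constructor
      · rintro ⟨h1, h2⟩; exact ⟨(this.1 ⟨h1, h2.trans_le ha⟩).1, h2⟩
      · rintro ⟨h1, h2⟩; exact ⟨(this.2 ⟨h1, h2.trans_le ha⟩).1, h2⟩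
    have h1 := gap_add_card_filter S a
    have h2 := gap_add_card_filter S' a
    rw [e] at h1
    omega
  unfold increment
  rw [h, hg c le_rfl]
  congr 2
  exact Finset.sum_congr rfl fun a ha => by rw [hg a (Finset.mem_filter.1 ha).2.le]

lemma denomFactor_eq (hq : q ≠ 0) (π : Equiv.Perm (Fin n)) (k : Fin n) :
    denomFactor q x π k = setDenom q x (prefixSet π k) := by
  have hu : (word (longPerm n)).toFinset = Finset.univ := by
    ext a
    simp only [List.mem_toFinset, Finset.mem_univ, iff_true]
    exact List.mem_ofFn.2 ((longPerm n).surjective a)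
  have hz : q ^ ((((k : ℕ) : ℤ) + 1) - (n : ℤ) - 1) = q ^ (k : ℕ) / q ^ n := by
    rw [← zpow_natCast, ← zpow_natCast, ← zpow_sub₀ hq]
    congr 1
    ring
  unfold denomFactor setDenom
  rw [hz, kappa_eq_setKappa (nodup_word _), hu,
    kappa_eq_setKappa ((nodup_word π).sublist (List.take_sublist _ _)), toFinset_take_word,
    card_prefixSet π k.isLt.le]
  have : setKappa q x Finset.univ = ∑ i, x i := by simp [setKappa, gap]
  rw [this]
  ring

lemma minFactor_eq {π : Equiv.Perm (Fin n)} {k : Fin n} (hk : k ∈ LRM π) :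
    minFactor q x π k = increment q x (prefixSet π k) (π k) := by
  have hk' : ∀ i, i < k → π k < π i := (Finset.mem_filter.1 hk).2
  have e : (prefixSet π k).filter (· < π k) = (∅ : Finset (Fin n)).filter (· < π k) := by
    rw [Finset.filter_empty, Finset.filter_eq_empty_iff]
    intro a ha
    obtain ⟨i, rfl⟩ := π.surjective a
    exact (hk' i (apply_mem_prefixSet.1 ha)).not_gt
  have h2 := gap_add_card_filter {π k} (π k)
  rw [Finset.filter_singleton, if_neg (lt_irrefl _), Finset.card_empty, add_zero] at h2
  rw [increment_congr e, increment_empty, minFactor, kappa_eq_setKappa (List.nodup_singleton _),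
    List.toFinset_cons, List.toFinset_nil, insert_empty_eq, setKappa, Finset.sum_singleton, h2]

lemma firstSmaller_le {π : Equiv.Perm (Fin n)} {i k : Fin n} (hik : i < k) (h : π i < π k) :
    firstSmaller π k ≤ i :=
  Nat.sInf_le ⟨i, rfl, hik, h⟩

/-- No letter before `firstSmaller π k` is below `π k`, so the shortened tuple and the full prefix
have the same letters below `π k`, hence the same increment. -/
lemma nonminFactor_eq (hq : q ≠ 0) {π : Equiv.Perm (Fin n)} {k : Fin n} (hk : k ∉ LRM π) :
    nonminFactor q x π k = increment q x (prefixSet π k) (π k) := by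
  obtain ⟨i, hik, hi⟩ : ∃ i, i < k ∧ π i < π k := by
    by_contra! h
    exact hk (Finset.mem_filter.2 ⟨Finset.mem_univ _, fun i hi =>
      lt_of_le_of_ne (h i hi) (π.injective.ne hi.ne')⟩)
  have hp : firstSmaller π k ≤ k := (firstSmaller_le hik hi).trans hik.le
  have hnd : ∀ m, (((word π).take m).drop (firstSmaller π k)).Nodup := fun m =>
    (nodup_word π).sublist ((List.drop_sublist _ _).trans (List.take_sublist _ _))
  set A := (((word π).take k).drop (firstSmaller π k)).toFinset with hA
  have hins : (((word π).take (k + 1)).drop (firstSmaller π k)).toFinset = insert (π k) A := by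
    ext a
    obtain ⟨j, rfl⟩ := π.surjective a
    rw [Finset.mem_insert, hA, List.mem_toFinset, List.mem_toFinset, mem_drop_take_word,
      mem_drop_take_word, π.injective.eq_iff, Fin.ext_iff]
    omega
  have hkA : π k ∉ A := by
    rw [hA, List.mem_toFinset, mem_drop_take_word]
    omega
  have e : A.filter (· < π k) = (prefixSet π k).filter (· < π k) := by
    ext a
    obtain ⟨j, rfl⟩ := π.surjective a
    rw [Finset.mem_filter, Finset.mem_filter, hA, List.mem_toFinset, mem_drop_take_word,
      apply_mem_prefixSet]
    exact ⟨fun h => ⟨h.1.2, h.2⟩, fun h => ⟨⟨firstSmaller_le h.1 h.2, h.1⟩, h.2⟩⟩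
  rw [nonminFactor, kappa_eq_setKappa (hnd _), kappa_eq_setKappa (hnd _), hins, ← hA,
    setKappa_insert hq hkA, add_sub_cancel_left, increment_congr e]

/-- The letters below `π k` missing from the prefix are the smaller letters to its right, so the gap
counts the inversions whose left end is `k`. -/
lemma inv_eq_sum_gap (π : Equiv.Perm (Fin n)) :
    inv π = ∑ k : Fin n, gap (prefixSet π k) (π k) := by
  rw [inv, Finset.card_filter, Fintype.sum_prod_type]
  refine Finset.sum_congr rfl fun k _ => ?_
  rw [← Finset.card_filter, gap, ← Finset.card_map π.toEmbedding]
  congr 1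
  ext a
  obtain ⟨i, rfl⟩ := π.surjective a
  have h : k < i ∧ π i < π k ↔ (k : ℕ) ≤ i ∧ π i < π k := by
    constructor
    · exact fun h => ⟨le_of_lt h.1, h.2⟩
    · exact fun h => ⟨lt_of_le_of_ne h.1 (by rintro rfl; exact lt_irrefl _ h.2), h.2⟩
  simp [apply_mem_prefixSet, h]

lemma stationaryFormula_eq (hq : 1 ≤ q) (hx : ∀ i, 0 < x i) (π : Equiv.Perm (Fin n)) :
    stationaryFormula q x π = prefixProb q x n π := by
  have h0 : q ≠ 0 := by linarith
  -- The formula omits the last position, where the step probability is 1 and the gap is 0.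
  have hlast : ∀ k : Fin n, k ∉ positions n → (k : ℕ) + 1 = n := by
    intro k hk
    have : ¬ ((k : ℕ) + 1 < n) := fun h => hk (Finset.mem_filter.2 ⟨Finset.mem_univ _, h⟩)
    omega
  have hinv : q ^ (-(inv π : ℤ)) = ∏ k ∈ positions n, (q ^ gap (prefixSet π k) (π k))⁻¹ := by
    rw [zpow_neg, zpow_natCast, inv_eq_sum_gap, Finset.prod_inv_distrib, Finset.prod_pow_eq_pow_sum,
      Finset.sum_subset (Finset.subset_univ (positions n)) fun k _ hk =>
        gap_prefixSet_last k (hlast k hk) π]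
  have hnum : (∏ k ∈ (positions n).filter (fun k => k ∈ LRM π), minFactor q x π k) *
      ∏ k ∈ (positions n).filter (fun k => k ∉ LRM π), nonminFactor q x π k
        = ∏ k ∈ positions n, increment q x (prefixSet π k) (π k) := by
    rw [Finset.prod_congr rfl fun k hk => minFactor_eq (Finset.mem_filter.1 hk).2,
      Finset.prod_congr rfl fun k hk => nonminFactor_eq h0 (Finset.mem_filter.1 hk).2,
      Finset.prod_filter_mul_prod_filter_not]
  have hfull : prefixProb q x n π = ∏ k ∈ positions n, stepProb q x k π := by
    rw [prefixProb, Finset.filter_true_of_mem fun k _ => k.isLt]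
    exact (Finset.prod_subset (Finset.subset_univ (positions n)) fun k _ hk =>
      stepProb_last hq hx k (hlast k hk) π).symm
  rw [stationaryFormula, hnum, hinv, Finset.prod_congr rfl fun k _ => denomFactor_eq h0 π k, hfull,
    ← Finset.prod_div_distrib, ← Finset.prod_mul_distrib]
  refine Finset.prod_congr rfl fun k _ => ?_
  rw [stepProb, condProb]
  field_simp

end Formula

end QTsetlin

theorem mainTheorem1 (n : ℕ) [NeZero n] (q : ℝ) (hq : 1 ≤ q)
    (x : Fin n → ℝ) (hx : ∀ i, 0 < x i) :
    (∀ Ψ : QTsetlin.PermSpace n, QTsetlin.IsStationaryDistribution q x Ψ ↔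
      ∀ π : Equiv.Perm (Fin n), Ψ π = QTsetlin.stationaryFormula q x π) ∧
    (∀ π : Equiv.Perm (Fin n),
      0 < q ^ (-(QTsetlin.inv π : ℤ)) ∧
      (∀ k ∈ QTsetlin.positions n, 0 < QTsetlin.denomFactor q x π k) ∧
      (∀ k ∈ QTsetlin.positions n, k ∈ QTsetlin.LRM π → 0 < QTsetlin.minFactor q x π k) ∧
      (∀ k ∈ QTsetlin.positions n, k ∉ QTsetlin.LRM π → 0 < QTsetlin.nonminFactor q x π k)) ∧
    ∑ π : Equiv.Perm (Fin n), QTsetlin.stationaryFormula q x π = 1 := by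
  have h0 : 0 < q := by linarith
  refine ⟨fun Ψ => ?_, fun π => ⟨zpow_pos h0 _, fun k _ => ?_, fun k _ hk => ?_, fun k _ hk => ?_⟩,
    ?_⟩
  · simp only [QTsetlin.stationaryFormula_eq hq hx]
    exact QTsetlin.isStationaryDistribution_iff hq hx Ψ
  · rw [QTsetlin.denomFactor_eq h0.ne']
    exact QTsetlin.setDenom_pos hq hx (QTsetlin.apply_notMem_prefixSet π k)
  · rw [QTsetlin.minFactor_eq hk]
    exact QTsetlin.increment_pos hq hx
  · rw [QTsetlin.nonminFactor_eq h0.ne' hk]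
    exact QTsetlin.increment_pos hq hx
  · simp only [QTsetlin.stationaryFormula_eq hq hx]
    exact QTsetlin.sum_prefixProb hq hx
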